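/- Let $F$ be a field, $A$ a finitely generated torsion-free abelian group, and $\lambda : A\times A\to F^*$ a $2$-cocycle, i.e. $\lambda(a_1,a_2)\lambda(a_1a_2,a_3)=\lambda(a_2,a_3)\lambda(a_1,a_2a_3)$. Let $\mathcal A = F*A=\bigoplus_{a\in A}F\bar a$ be the twisted group algebra, with multiplication $\bar a_1\bar a_2=\lambda(a_1,a_2)\overline{a_1a_2}$. Let $B$ be a subgroup of $A$ such that $A/B$ is infinite cyclic, let $t\in A$ be such that $tB$ generates $A/B$, and let $\mathcal B = F*B\subseteq\mathcal A$ be the subalgebra of elements with support in $B$. The set $S=\mathcal B\setminus\{0\}$ is a (two-sided) Ore subset of $\mathcal A$; let $\Sigma=\mathcal A S^{-1}\supseteq\mathcal A$ be the ring of fractions. An element $\alpha\in\mathcal A$ is called unitary with respect to $\bar t$ if $\alpha=\sum_{i=p}^{q}\beta_i\bar t^{\,i}$ with integers $p\le q$ and $\beta_i\in\mathcal B$ such that $\beta_p$ and $\beta_q$ are units of $\mathcal B$. For a right $\mathcal A$-module $M$ let $\operatorname{GK}(M)=\sup_{V,W}\limsup_{k\to\infty}\frac{\log\dim_F(WV^k)}{\log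 k}$ be its Gelfand--Kirillov dimension, where $V$ and $W$ run over the finite-dimensional $F$-subspaces of $\mathcal A$ and of $M$ respectively (with $\log 0=-\infty$, so that $\operatorname{GK}(0)=-\infty$). Let $\mathfrak m$ be a maximal right ideal of $\Sigma$, and let $S(\mathfrak m)=\mathcal A/(\mathcal A\cap\mathfrak m)$, a cyclic right $\mathcal A$-module. If $\mathcal A\cap\mathfrak m$ contains an element that is unitary with respect to $\bar t$, then $S(\mathfrak m)$ is GK-critical: for every nonzero submodule $W_1$ of $S(\mathfrak m)$, $$\operatorname{GK}(S(\mathfrak m)/W_1)<\operatorname{GK}(S(\mathfrak m)).$$ -/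

import Mathlib

open Filter Pointwise

universe u v w

/-- A `2`-cocycle `A × A → Fˣ` (trivial action), not assumed to be normalized. -/
structure TwoCocycle (F : Type u) (A : Type v) [Field F] [CommGroup A] where
  toFun : A → A → Fˣ
  cocycle : ∀ a₁ a₂ a₃ : A,
    toFun a₁ a₂ * toFun (a₁ * a₂) a₃ = toFun a₂ a₃ * toFun a₁ (a₂ * a₃)

/-- The twisted group algebra `F * A`: the `F`-vector space with basis `ā` (`a ∈ A`) and the
multiplication `ā₁ ā₂ = c(a₁, a₂) \overline{a₁ a₂}`. -/
def TwistedGroupAlgebra {F : Type u} {A : Type v} [Field F] [CommGroup A]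
    (_c : TwoCocycle F A) : Type (max u v) := A →₀ F

namespace TwistedGroupAlgebra

section Construction

variable {F : Type u} {A : Type v} [Field F] [CommGroup A] {c : TwoCocycle F A}

noncomputable instance : AddCommGroup (TwistedGroupAlgebra c) :=
  inferInstanceAs (AddCommGroup (A →₀ F))

noncomputable instance : Module F (TwistedGroupAlgebra c) :=
  inferInstanceAs (Module F (A →₀ F))


/-- The basis `(ā)`, `a ∈ A`, of `F * A`. -/
noncomputable def basis (c : TwoCocycle F A) : Module.Basis A F (TwistedGroupAlgebra c) :=
  .ofRepr (LinearEquiv.refl F (A →₀ F) : TwistedGroupAlgebra c ≃ₗ[F] (A →₀ F))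

/-- The support in `A` of an element of `F * A`. -/
noncomputable def support (x : TwistedGroupAlgebra c) : Finset A := ((basis c).repr x).support

/-- The multiplication of `F * A`, as a bilinear map. -/
noncomputable def mulBilin (c : TwoCocycle F A) :
    TwistedGroupAlgebra c →ₗ[F] TwistedGroupAlgebra c →ₗ[F] TwistedGroupAlgebra c :=
  (basis c).constr F fun a => (basis c).constr F fun b => (c.toFun a b : F) • basis c (a * b)

noncomputable instance : Mul (TwistedGroupAlgebra c) := ⟨fun x y => mulBilin c x y⟩

noncomputable instance : One (TwistedGroupAlgebra c) :=
  ⟨((c.toFun 1 1)⁻¹ : Fˣ) • basis c 1⟩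

theorem mul_def (x y : TwistedGroupAlgebra c) : x * y = mulBilin c x y := rfl

theorem one_def : (1 : TwistedGroupAlgebra c) = ((c.toFun 1 1)⁻¹ : Fˣ) • basis c 1 := rfl

theorem mulBilin_basis (a b : A) :
    mulBilin c (basis c a) (basis c b) = (c.toFun a b : F) • basis c (a * b) := by
  simp [mulBilin]

theorem cocycle_one_left (b : A) : c.toFun 1 b = c.toFun 1 1 := by
  have h := c.cocycle 1 1 b
  simp only [one_mul] at h
  exact (mul_right_cancel (h.trans (mul_comm _ _))).symm

theorem cocycle_one_right (b : A) : c.toFun b 1 = c.toFun 1 1 := by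
  have h := c.cocycle b 1 1
  simp only [mul_one] at h
  exact mul_right_cancel h

theorem mul_assoc_aux (x y z : TwistedGroupAlgebra c) :
    mulBilin c (mulBilin c x y) z = mulBilin c x (mulBilin c y z) := by
  have key : ∀ a b d : A,
      mulBilin c (mulBilin c (basis c a) (basis c b)) (basis c d)
        = mulBilin c (basis c a) (mulBilin c (basis c b) (basis c d)) := by
    intro a b d
    have h := congrArg Units.val (c.cocycle a b d)
    push_cast at h
    simp only [mulBilin_basis, map_smul, LinearMap.smul_apply, smul_smul, mul_assoc a b d, h]
  have h1 : ∀ (a b : A) (z : TwistedGroupAlgebra c),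
      mulBilin c (mulBilin c (basis c a) (basis c b)) z
        = mulBilin c (basis c a) (mulBilin c (basis c b) z) := by
    intro a b z
    exact LinearMap.congr_fun (f := mulBilin c (mulBilin c (basis c a) (basis c b)))
      (g := mulBilin c (basis c a) ∘ₗ mulBilin c (basis c b))
      ((basis c).ext fun d => key a b d) z
  have h2 : ∀ (a : A) (y z : TwistedGroupAlgebra c),
      mulBilin c (mulBilin c (basis c a) y) z
        = mulBilin c (basis c a) (mulBilin c y z) := by
    intro a y z
    exact LinearMap.congr_fun (f := (mulBilin c).flip z ∘ₗ mulBilin c (basis c a))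
      (g := mulBilin c (basis c a) ∘ₗ (mulBilin c).flip z)
      ((basis c).ext fun b => h1 a b z) y
  exact LinearMap.congr_fun (f := (mulBilin c).flip z ∘ₗ (mulBilin c).flip y)
      (g := (mulBilin c).flip (mulBilin c y z))
      ((basis c).ext fun a => h2 a y z) x

noncomputable instance : Ring (TwistedGroupAlgebra c) where
  left_distrib x y z := by simp [mul_def]
  right_distrib x y z := by simp [mul_def]
  zero_mul x := by simp [mul_def]
  mul_zero x := by simp [mul_def]
  mul_assoc := mul_assoc_aux
  one_mul x := LinearMap.congr_fun (f := mulBilin c 1) (g := LinearMap.id)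
    ((basis c).ext fun a => by
      simp [one_def, Units.smul_def, mulBilin_basis, cocycle_one_left a]) x
  mul_one x := LinearMap.congr_fun (f := (mulBilin c).flip 1) (g := LinearMap.id)
    ((basis c).ext fun a => by
      simp [one_def, Units.smul_def, mulBilin_basis, cocycle_one_right a]) x
  neg_add_cancel := neg_add_cancel
  zsmul := (· • ·)
  nsmul := (· • ·)
  zsmul_zero' := SubNegMonoid.zsmul_zero'
  zsmul_succ' := SubNegMonoid.zsmul_succ'
  zsmul_neg' := SubNegMonoid.zsmul_neg'
  nsmul_zero := AddMonoid.nsmul_zero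
  nsmul_succ := AddMonoid.nsmul_succ
  sub_eq_add_neg := sub_eq_add_neg

noncomputable instance : Algebra F (TwistedGroupAlgebra c) :=
  Algebra.ofModule (fun r x y => by simp [mul_def]) (fun r x y => by simp [mul_def])

theorem basis_mul_basis (a b : A) :
    basis c a * basis c b = (c.toFun a b : F) • basis c (a * b) := mulBilin_basis a b

/-- The basis element `ā`, as a unit of `F * A`. -/
noncomputable def bar (c : TwoCocycle F A) (a : A) : (TwistedGroupAlgebra c)ˣ where
  val := basis c a
  inv := ((c.toFun a a⁻¹ * c.toFun 1 1)⁻¹ : Fˣ) • basis c a⁻¹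
  val_inv := by
    rw [mul_smul_comm, basis_mul_basis, one_def, mul_inv_cancel]
    simp [Units.smul_def, smul_smul]
  inv_val := by
    have h := c.cocycle a a⁻¹ a
    rw [mul_inv_cancel, inv_mul_cancel, cocycle_one_left, cocycle_one_right a] at h
    have h := mul_right_cancel h
    rw [smul_mul_assoc, basis_mul_basis, one_def, inv_mul_cancel, ← h]
    simp [Units.smul_def, smul_smul]

theorem mul_eq_sum (x y : TwistedGroupAlgebra c) :
    x * y = ∑ a ∈ x.support, ∑ b ∈ y.support,
      ((basis c).repr x a * (basis c).repr y b * c.toFun a b) • basis c (a * b) := by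
  conv_lhs => rw [← (basis c).linearCombination_repr x, ← (basis c).linearCombination_repr y]
  simp only [Finsupp.linearCombination_apply, Finsupp.sum, Finset.sum_mul_sum, smul_mul_smul_comm,
    basis_mul_basis, smul_smul]
  rfl

theorem support_mul [DecidableEq A] (x y : TwistedGroupAlgebra c) :
    (x * y).support ⊆ x.support * y.support := by
  intro d hd
  by_contra hd'
  refine (Finsupp.mem_support_iff.mp hd) ?_
  rw [mul_eq_sum]
  simp only [map_sum, map_smul, Module.Basis.repr_self, Finsupp.finsetSum_apply, Finsupp.smul_apply]
  refine Finset.sum_eq_zero fun a ha => Finset.sum_eq_zero fun b hb => ?_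
  rw [Finsupp.single_eq_of_ne, smul_zero]
  rintro rfl
  exact hd' (Finset.mul_mem_mul ha hb)

theorem support_eq_empty {x : TwistedGroupAlgebra c} : x.support = ∅ ↔ x = 0 := by
  simp [support]

theorem support_one_subset : (1 : TwistedGroupAlgebra c).support ⊆ {1} := by
  rw [support, one_def, Units.smul_def, map_smul, Module.Basis.repr_self]
  exact Finsupp.support_smul.trans Finsupp.support_single_subset

theorem support_smul (r : F) (x : TwistedGroupAlgebra c) : (r • x).support ⊆ x.support := by
  rw [support, map_smul]
  exact Finsupp.support_smul

theorem support_add [DecidableEq A] (x y : TwistedGroupAlgebra c) :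
    (x + y).support ⊆ x.support ∪ y.support := by
  rw [support, map_add]
  exact Finsupp.support_add

instance [Group.FG A] [IsMulTorsionFree A] : NoZeroDivisors (TwistedGroupAlgebra c) where
  eq_zero_or_eq_zero_of_mul_eq_zero {x y} h := by
    by_contra! hxy
    have hx := Finset.nonempty_iff_ne_empty.mpr (mt support_eq_empty.mp hxy.1)
    have hy := Finset.nonempty_iff_ne_empty.mpr (mt support_eq_empty.mp hxy.2)
    have : Monoid.FG A := Group.fg_iff_monoid_fg.mp inferInstance
    obtain ⟨a, ha, b, hb, hu⟩ := UniqueProds.uniqueMul_of_nonempty hx hy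
    have h' := congrArg (fun z => (basis c).repr z (a * b)) h
    simp only [mul_eq_sum, map_sum, map_smul, Module.Basis.repr_self, Finsupp.finsetSum_apply,
      Finsupp.smul_apply, map_zero, Finsupp.zero_apply] at h'
    rw [Finset.sum_eq_single_of_mem a ha, Finset.sum_eq_single_of_mem b hb] at h'
    · simp only [Finsupp.single_eq_same, smul_eq_mul, mul_one, mul_eq_zero, Units.ne_zero,
        or_false] at h'
      exact h'.elim (Finsupp.mem_support_iff.mp ha) (Finsupp.mem_support_iff.mp hb)
    · intro b' hb' hne
      rw [Finsupp.single_eq_of_ne, smul_zero]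
      intro he
      exact hne (hu ha hb' he.symm).2
    · intro a' ha' hne
      refine Finset.sum_eq_zero fun b' hb' => ?_
      rw [Finsupp.single_eq_of_ne, smul_zero]
      intro he
      exact hne (hu ha' hb' he.symm).1

/-- The subalgebra `F * B` of `F * A`: the elements with support in the subgroup `B`. -/
noncomputable def subgroupAlgebra (c : TwoCocycle F A) (B : Subgroup A) :
    Subalgebra F (TwistedGroupAlgebra c) where
  carrier := {x | ∀ a ∈ x.support, a ∈ B}
  mul_mem' {x y} hx hy a ha := by
    classical
    obtain ⟨b, hb, d, hd, rfl⟩ := Finset.mem_mul.mp (support_mul x y ha)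
    exact B.mul_mem (hx b hb) (hy d hd)
  add_mem' {x y} hx hy a ha := by
    classical
    exact (Finset.mem_union.mp (support_add x y ha)).elim (hx a) (hy a)
  algebraMap_mem' r a ha := by
    rw [Algebra.algebraMap_eq_smul_one] at ha
    rw [Finset.mem_singleton.mp (support_one_subset (support_smul _ _ ha))]
    exact B.one_mem

/-- The multiplicative set `S = (F * B) \ {0}` of `F * A`. -/
def nonzeroSubmonoid (c : TwoCocycle F A) (B : Subgroup A) [Group.FG A] [IsMulTorsionFree A] :
    Submonoid (TwistedGroupAlgebra c) where
  carrier := {x | x ∈ subgroupAlgebra c B ∧ x ≠ 0}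
  mul_mem' hx hy := ⟨mul_mem hx.1 hy.1, mul_ne_zero hx.2 hy.2⟩
  one_mem' := ⟨one_mem _, fun h => (basis c).ne_zero 1 <| by
    rw [← one_mul (basis c 1), h, zero_mul]⟩

/-- The sets of words in a finite subset of a commutative group grow polynomially. -/
theorem card_pow_le [DecidableEq A] (Y : Finset A) (m : ℕ) : (Y ^ m).card ≤ (m + 1) ^ Y.card := by
  have key : ∀ m : ℕ, ∀ z ∈ Y ^ m, ∃ f : A → ℕ, (∀ y, f y ≤ m) ∧ z = ∏ y ∈ Y, y ^ f y := by
    intro m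
    induction m with
    | zero => intro z hz; exact ⟨fun _ => 0, fun _ => le_rfl, by simpa using hz⟩
    | succ m ih =>
      intro z hz
      rw [pow_succ] at hz
      obtain ⟨w, hw, y, hy, rfl⟩ := Finset.mem_mul.mp hz
      obtain ⟨f, hf, rfl⟩ := ih w hw
      refine ⟨fun a => f a + if a = y then 1 else 0, fun a => ?_, ?_⟩
      · have := hf a
        dsimp only
        split_ifs <;> omega
      · simp only [pow_add, Finset.prod_mul_distrib]
        congr 1
        rw [Finset.prod_eq_single y] <;> simp_all
  calc (Y ^ m).card
      ≤ ((Fintype.piFinset fun _ : Y => Finset.range (m + 1)).image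
          fun f => ∏ y : Y, (y : A) ^ f y).card := by
        refine Finset.card_le_card fun z hz => ?_
        obtain ⟨f, hf, rfl⟩ := key m z hz
        refine Finset.mem_image.mpr ⟨fun y => f y, ?_, ?_⟩
        · simp only [Fintype.mem_piFinset, Finset.mem_range]
          exact fun y => Nat.lt_succ_of_le (hf y)
        · exact Finset.prod_coe_sort Y fun y => y ^ f y
    _ ≤ _ := Finset.card_image_le
    _ = _ := by simp

theorem exists_small_growth [DecidableEq A] (Y : Finset A) (k : ℕ) :
    ∃ m : ℕ, k * (Y ^ (m + 1)).card < (k + 1) * (Y ^ m).card := by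
  rcases Nat.eq_zero_or_pos k with rfl | hk
  · exact ⟨0, by simp⟩
  by_contra! h
  have h1 : ∀ m : ℕ, (k + 1) ^ m ≤ k ^ m * (Y ^ m).card := by
    intro m
    induction m with
    | zero => simp
    | succ m ih =>
      calc (k + 1) ^ (m + 1) = (k + 1) * (k + 1) ^ m := by ring
        _ ≤ (k + 1) * (k ^ m * (Y ^ m).card) := Nat.mul_le_mul_left _ ih
        _ = k ^ m * ((k + 1) * (Y ^ m).card) := by ring
        _ ≤ k ^ m * (k * (Y ^ (m + 1)).card) := Nat.mul_le_mul_left _ (h m)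
        _ = _ := by ring
  have hk' : (0 : ℝ) < k := by exact_mod_cast hk
  set r : ℝ := (k + 1) / k with hr
  have hr1 : 1 < r := by rw [hr, one_lt_div hk']; linarith
  have h2 : ∀ m : ℕ, r ^ m ≤ ((m + 1 : ℕ) : ℝ) ^ Y.card := by
    intro m
    rw [hr, div_pow, div_le_iff₀ (by positivity), mul_comm]
    exact_mod_cast (h1 m).trans (Nat.mul_le_mul_left _ (card_pow_le Y m))
  have h3 := (tendsto_pow_const_div_const_pow_of_one_lt Y.card hr1).comp (tendsto_add_atTop_nat 1)
  have h4 : ∀ m : ℕ, r⁻¹ ≤ (((m + 1 : ℕ) : ℝ) ^ Y.card / r ^ (m + 1)) := by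
    intro m
    have hr0 : 0 < r := by linarith
    rw [le_div_iff₀ (by positivity), pow_succ, mul_comm (r ^ m), inv_mul_cancel_left₀ hr0.ne']
    exact h2 m
  have := ge_of_tendsto' h3 h4
  have : 0 < r⁻¹ := by positivity
  linarith

/-- A dimension count behind both Ore conditions. -/
theorem exists_common_multiple (B : Subgroup A) (a s : TwistedGroupAlgebra c)
    (hsB : s ∈ subgroupAlgebra c B) (f g : TwistedGroupAlgebra c →ₗ[F] TwistedGroupAlgebra c)
    (hf : ∀ x d, d ∈ (f x).support → ∃ p ∈ x.support, ∃ q ∈ a.support, p * q = d)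
    (hg : ∀ x d, d ∈ (g x).support → ∃ p ∈ x.support, ∃ q ∈ s.support, p * q = d)
    (hg0 : ∀ x, g x = 0 → x = 0) :
    ∃ x ∈ subgroupAlgebra c B, x ≠ 0 ∧ ∃ y, f x = g y := by
  classical
  let ρ : A → A := fun a => ((a : A ⧸ B)).out
  have hρ : ∀ a, ρ (ρ a) = ρ a := fun a => by simp [ρ]
  have hρB : ∀ a, (ρ a)⁻¹ * a ∈ B := fun a => QuotientGroup.eq.mp (by simp [ρ])
  let T : Finset A := a.support.image ρ
  let Y : Finset A := insert 1 (s.support ∪ a.support.image fun d => (ρ d)⁻¹ * d)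
  have hYB : ∀ y ∈ Y, y ∈ B := by
    intro y hy
    simp only [Y, Finset.mem_insert, Finset.mem_union, Finset.mem_image] at hy
    rcases hy with rfl | hy | ⟨d, -, rfl⟩
    · exact B.one_mem
    · exact hsB y hy
    · exact hρB d
  obtain ⟨m, hm⟩ := exists_small_growth Y T.card
  set X : Finset A := Y ^ m with hX
  have hXB : ∀ n : ℕ, ∀ x ∈ Y ^ n, x ∈ B := by
    intro n
    induction n with
    | zero => intro x hx; rw [pow_zero, Finset.mem_one] at hx; rw [hx]; exact B.one_mem
    | succ n ih =>
      intro x hx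
      rw [pow_succ] at hx
      obtain ⟨p, hp, q, hq, rfl⟩ := Finset.mem_mul.mp hx
      exact B.mul_mem (ih p hp) (hYB q hq)
  have hcard : (T * X).card = T.card * X.card := by
    refine Finset.card_mul_iff.mpr ?_
    rintro ⟨t, x⟩ ⟨ht, hx⟩ ⟨t', x'⟩ ⟨ht', hx'⟩ h
    dsimp only at h ht hx ht' hx'
    obtain ⟨d, -, rfl⟩ := Finset.mem_image.mp (Finset.mem_coe.mp ht)
    obtain ⟨d', -, rfl⟩ := Finset.mem_image.mp (Finset.mem_coe.mp ht')
    have : ρ d = ρ d' := by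
      rw [← hρ d, ← hρ d']
      change Quotient.out _ = Quotient.out _
      congr 1
      refine QuotientGroup.eq.mpr ?_
      have : (ρ d)⁻¹ * ρ d' = x * x'⁻¹ := by
        rw [inv_mul_eq_iff_eq_mul, ← mul_assoc, h, mul_inv_cancel_right]
      rw [this]
      exact B.mul_mem (hXB m _ hx) (B.inv_mem (hXB m _ hx'))
    rw [this] at h ⊢
    rw [mul_left_cancel h]
  let e := (basis c).repr
  let V : Finset A → Submodule F (TwistedGroupAlgebra c) := fun Z =>
    (Finsupp.supported F F (Z : Set A)).comap e.toLinearMap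
  have hV : ∀ Z x, x ∈ V Z ↔ x.support ⊆ Z := by
    intro Z x
    simp [V, Finsupp.mem_supported, support, e]
  have hrank : ∀ Z, Module.finrank F (V Z) = Z.card ∧ Module.Finite F (V Z) := by
    intro Z
    let e' : V Z ≃ₗ[F] (Z →₀ F) :=
      (e.ofSubmodule' (Finsupp.supported F F (Z : Set A))).trans
        (Finsupp.supportedEquivFinsupp (Z : Set A))
    exact ⟨by rw [e'.finrank_eq]; simp, Module.Finite.equiv e'.symm⟩
  have := fun Z => (hrank Z).2
  let L : (V X × V (T * X)) →ₗ[F] TwistedGroupAlgebra c :=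
    (f ∘ₗ (V X).subtype).coprod (-(g ∘ₗ (V (T * X)).subtype))
  have hL : ∀ z, L z ∈ V (T * Y ^ (m + 1)) := by
    rintro ⟨x, y⟩
    have h1 : f x ∈ V (T * Y ^ (m + 1)) := by
      rw [hV]
      intro d hd
      obtain ⟨p, hp, q, hq, rfl⟩ := hf _ _ hd
      have hp := (hV _ _).mp x.2 hp
      rw [show p * q = ρ q * (p * ((ρ q)⁻¹ * q)) by
        rw [mul_left_comm p, mul_inv_cancel_left], pow_succ]
      refine Finset.mul_mem_mul (Finset.mem_image_of_mem _ hq) (Finset.mul_mem_mul hp ?_)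
      simp only [Y, Finset.mem_insert, Finset.mem_union, Finset.mem_image]
      exact Or.inr (Or.inr ⟨q, hq, rfl⟩)
    have h2 : g y ∈ V (T * Y ^ (m + 1)) := by
      rw [hV]
      intro d hd
      obtain ⟨p, hp, q, hq, rfl⟩ := hg _ _ hd
      have hp := (hV _ _).mp y.2 hp
      rw [pow_succ, ← mul_assoc]
      refine Finset.mul_mem_mul hp ?_
      simp only [Y, Finset.mem_insert, Finset.mem_union, Finset.mem_image]
      exact Or.inr (Or.inl hq)
    simpa [L] using Submodule.add_mem _ h1 (Submodule.neg_mem _ h2)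
  have hker : ¬ Function.Injective (L.codRestrict _ hL) := by
    intro hinj
    have h1 := LinearMap.finrank_le_finrank_of_injective hinj
    rw [Module.finrank_prod, (hrank _).1, (hrank _).1, (hrank _).1, hcard] at h1
    have h2 : (T * Y ^ (m + 1)).card ≤ T.card * (Y ^ (m + 1)).card := Finset.card_mul_le
    have h3 : (T.card + 1) * X.card = X.card + T.card * X.card := by ring
    omega
  rw [← LinearMap.ker_eq_bot, Submodule.eq_bot_iff] at hker
  push Not at hker
  obtain ⟨⟨x, y⟩, hxy, hne⟩ := hker
  have hxy : f x = g y := by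
    have : L (x, y) = 0 := congrArg Subtype.val (LinearMap.mem_ker.mp hxy)
    simpa [L, add_neg_eq_zero] using this
  refine ⟨x, fun d hd => hXB m d ((hV _ _).mp x.2 hd), ?_, y, hxy⟩
  intro hx
  refine hne ?_
  rw [hx, map_zero] at hxy
  have hy := hg0 _ hxy.symm
  exact Prod.ext (Subtype.ext hx) (Subtype.ext hy)

/-- An element `α` of `F * A` is unitary with respect to `t̄` if
`α = ∑_{i = p}^q βᵢ t̄ⁱ` with `p ≤ q`, all `βᵢ ∈ F * B`, and `β_p`, `β_q` units of `F * B`. -/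
def IsUnitary (c : TwoCocycle F A) (B : Subgroup A) (t : A) (α : TwistedGroupAlgebra c) : Prop :=
  ∃ (p q : ℤ) (β : ℤ → subgroupAlgebra c B), p ≤ q ∧ IsUnit (β p) ∧ IsUnit (β q) ∧
    α = ∑ i ∈ Finset.Icc p q, (β i : TwistedGroupAlgebra c) * ((bar c t ^ i : _ˣ) : _)

variable [Group.FG A] [IsMulTorsionFree A]

theorem leftOre (B : Subgroup A) (a : TwistedGroupAlgebra c) (s : nonzeroSubmonoid c B) :
    ∃ (a' : TwistedGroupAlgebra c) (s' : nonzeroSubmonoid c B), s' * a = a' * s := by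
  classical
  obtain ⟨x, hxB, hx, y, h⟩ := exists_common_multiple B a s s.2.1
    (LinearMap.mulRight F a) (LinearMap.mulRight F (s : TwistedGroupAlgebra c))
    (fun x d hd => Finset.mem_mul.mp (support_mul x a hd))
    (fun x d hd => Finset.mem_mul.mp (support_mul x s hd))
    (fun x hx => (mul_eq_zero.mp hx).resolve_right s.2.2)
  exact ⟨y, ⟨x, hxB, hx⟩, h⟩

theorem rightOre (B : Subgroup A) (a : TwistedGroupAlgebra c) (s : nonzeroSubmonoid c B) :
    ∃ (a' : TwistedGroupAlgebra c) (s' : nonzeroSubmonoid c B), a * s' = s * a' := by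
  classical
  have key : ∀ a x d, d ∈ (a * x : TwistedGroupAlgebra c).support →
      ∃ p ∈ x.support, ∃ q ∈ a.support, p * q = d := by
    intro a x d hd
    obtain ⟨p, hp, q, hq, rfl⟩ := Finset.mem_mul.mp (support_mul a x hd)
    exact ⟨q, hq, p, hp, mul_comm q p⟩
  obtain ⟨x, hxB, hx, y, h⟩ := exists_common_multiple B a s s.2.1
    (LinearMap.mulLeft F a) (LinearMap.mulLeft F (s : TwistedGroupAlgebra c))
    (key a) (key s)
    (fun x hx => (mul_eq_zero.mp hx).resolve_left s.2.2)
  exact ⟨y, ⟨x, hxB, hx⟩, h⟩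

noncomputable instance (B : Subgroup A) : OreLocalization.OreSet (nonzeroSubmonoid c B) :=
  (OreLocalization.nonempty_oreSet_iff_of_noZeroDivisors.mpr (leftOre B)).some

/-- The ring of fractions `Σ` of `F * A` at the (two-sided) Ore set `S = (F * B) \ {0}`. -/
abbrev FractionRing (c : TwoCocycle F A) (B : Subgroup A) : Type (max u v) :=
  OreLocalization (nonzeroSubmonoid c B) (TwistedGroupAlgebra c)

/-- The canonical map `F * A → Σ`. -/
noncomputable def toFractionRing (c : TwoCocycle F A) (B : Subgroup A) :
    TwistedGroupAlgebra c →+* FractionRing c B := OreLocalization.numeratorRingHom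

/-- `F * A` embeds in `Σ`. -/
theorem toFractionRing_injective (c : TwoCocycle F A) (B : Subgroup A) :
    Function.Injective (toFractionRing c B) :=
  OreLocalization.numeratorHom_inj fun s hs => by
    rw [mem_nonZeroDivisorsLeft_iff]
    exact fun x hx => (mul_eq_zero.mp hx).resolve_left hs.2

/-- The elements of `S` become invertible in `Σ`. -/
theorem isUnit_toFractionRing {B : Subgroup A} (s : nonzeroSubmonoid c B) :
    IsUnit (toFractionRing c B s) := OreLocalization.numerator_isUnit s

/-- Every element of `Σ` is a right fraction `α s⁻¹`, so `Σ` is the right ring of fractions. -/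
theorem exists_mul_eq {B : Subgroup A} (z : FractionRing c B) :
    ∃ (a : TwistedGroupAlgebra c) (s : nonzeroSubmonoid c B),
      z * toFractionRing c B s = toFractionRing c B a := by
  induction z using OreLocalization.ind with
  | _ r s =>
    obtain ⟨a, s', h⟩ := rightOre B r s
    refine ⟨a, s', ?_⟩
    refine (isUnit_toFractionRing s).mul_left_cancel ?_
    rw [← map_mul, ← h, ← mul_assoc, map_mul]
    congr 1
    exact OreLocalization.mul_cancel

/-- The right ideal `𝒜 ∩ 𝔪` of `𝒜 = F * A`, for a right ideal `𝔪` of `Σ`. -/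
noncomputable def contraction {B : Subgroup A}
    (m : Submodule (FractionRing c B)ᵐᵒᵖ (FractionRing c B)) :
    Submodule (TwistedGroupAlgebra c)ᵐᵒᵖ (TwistedGroupAlgebra c) where
  carrier := {x | toFractionRing c B x ∈ m}
  add_mem' hx hy := by simpa using m.add_mem hx hy
  zero_mem' := by simp
  smul_mem' r x hx := by
    simpa using m.smul_mem (MulOpposite.op (toFractionRing c B r.unop)) hx

/-- The right `F * A`-module `S(𝔪) = 𝒜 / (𝒜 ∩ 𝔪)`, where `𝒜 = F * A`. -/
abbrev ContractionModule {B : Subgroup A}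
    (m : Submodule (FractionRing c B)ᵐᵒᵖ (FractionRing c B)) :
    Type (max u v) :=
  TwistedGroupAlgebra c ⧸ contraction m

end Construction

end TwistedGroupAlgebra

section GKDimension

variable (F : Type u) (R : Type v) (M : Type w) [Field F] [Ring R] [Algebra F R]
  [AddCommGroup M] [Module F M] [Module Rᵐᵒᵖ M] [IsScalarTower F Rᵐᵒᵖ M]

variable {F R M} in
/-- The subspace `W U` of the right `R`-module `M`, spanned by the `w u` with `w ∈ W`, `u ∈ U`. -/
def subspaceMul (W : Submodule F M) (U : Submodule F R) : Submodule F M :=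
  Submodule.span F {x | ∃ w ∈ W, ∃ u ∈ U, x = MulOpposite.op u • w}

/-- The Gelfand–Kirillov dimension of a right module `M` over an `F`-algebra `R`: the supremum,
over the finite-dimensional subspaces `V` of `R` and `W` of `M`, of
`limsup_k log dim (W V ^ k) / log k`. The logarithm is extended by `log 0 = -∞`, so the zero
module has dimension `-∞`. -/
noncomputable def gkDim : EReal :=
  ⨆ (V : Submodule F R) (W : Submodule F M) (_ : V.FG) (_ : W.FG),
    limsup (fun k : ℕ =>
      ENNReal.log (Module.finrank F (subspaceMul W (V ^ k))) / ((Real.log k : ℝ) : EReal)) atTop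

/-- A right `R`-module `M` is GK-critical if `GK (M / W₁) < GK M` for every nonzero
submodule `W₁`. -/
def IsGKCritical : Prop :=
  ∀ W₁ : Submodule Rᵐᵒᵖ M, W₁ ≠ ⊥ → gkDim F R (M ⧸ W₁) < gkDim F R M

end GKDimension

/-!
Write `𝒜 = F * A`, `ℬ = F * B`, `I = 𝒜 ∩ 𝔪`, and choose an isomorphism `ℤ^r ≅ B`. The number `r`
separates the two Gelfand–Kirillov dimensions: `GK(𝒜 / I) ≥ r`, while a quotient of `𝒜 / I` by a
nonzero submodule has dimension at most `r - 1`, or is zero if `r = 0`.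

Lower bound (`le_gkDim_of_free`). A nonzero element of `ℬ` in `I` would be a unit of `Σ` in `𝔪`
(`eq_zero_of_mem_contraction`), so `b ↦ 1 · b` embeds `ℬ` in `𝒜 / I`. If `V` is spanned by the `ā`
with `a` in the cube `[-1, 1]^r` of `B`, then `1 · V^k` has dimension at least `(2 k + 1)^r`.

Upper bound (`exists_finrank_subspaceMul_le`). Let `J` be a right ideal that properly contains `I`.
* Since `𝔪` is maximal, `𝔪 + y Σ = Σ` for some `y ∈ J`, and clearing denominators shows that every
  element of `𝒜 / J` is killed by a nonzero element of `ℬ` (`exists_mul_mem_of_contraction_lt`).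
* The unitary element makes both its extreme powers of `t̄` combinations of the others modulo `I`.
  As `A` is commutative, moving powers of `t̄` past elements of `ℬ` does not change supports, so each
  such rewriting step enlarges the supports of coefficients by a constant. Hence `t̄^i` is a
  combination of finitely many fixed `t̄^j` with coefficients supported in a cube of size `O(|i|)`
  (`exists_basis_mem_sup_supportedOn_box`), and for finite-dimensional `V` and `W` the space `W V^k`
  lies in a finite sum of the spaces `t̄^j ℬ_L`, where `ℬ_L` is spanned by the cube of size `L` and
  `L = O(k)`.
* If `t̄^j b ∈ J` with `b ≠ 0` supported in the cube of size `d`, then `ℬ_L → 𝒜 / J`,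
  `x ↦ t̄^j x`, kills `b ℬ_{L - d}`, so its image has dimension at most
  `(2 L + 1)^r - (2 (L - d) + 1)^r = O(L^(r - 1))` (`finrank_map_supportedOn_box_le`).
-/

/-! ### Two estimates -/

theorem Nat.add_pow_le_pow_add_mul (x h r : ℕ) :
    (x + h) ^ r ≤ x ^ r + r * h * (x + h) ^ (r - 1) := by
  induction r with
  | zero => simp
  | succ r ih =>
    rcases r with _ | r
    · simp
    · simp only [Nat.add_sub_cancel] at ih ⊢
      calc (x + h) ^ (r + 1 + 1) = (x + h) ^ (r + 1) * x + h * (x + h) ^ (r + 1) := by ring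
        _ ≤ (x ^ (r + 1) + (r + 1) * h * (x + h) ^ r) * x + h * (x + h) ^ (r + 1) := by gcongr
        _ = x ^ (r + 1 + 1) + (r + 1) * h * ((x + h) ^ r * x) + h * (x + h) ^ (r + 1) := by ring
        _ ≤ x ^ (r + 1 + 1) + (r + 1) * h * ((x + h) ^ r * (x + h)) + h * (x + h) ^ (r + 1) := by
            gcongr; omega
        _ = _ := by ring

theorem Submodule.finrank_finset_sup_le {K V ι : Type*} [DivisionRing K] [AddCommGroup V]
    [Module K V] (s : Finset ι) (p : ι → Submodule K V) [∀ i, Module.Finite K (p i)] {n : ℕ}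
    (h : ∀ i ∈ s, Module.finrank K (p i) ≤ n) :
    Module.finrank K (s.sup p : Submodule K V) ≤ s.card * n := by
  classical
  induction s using Finset.induction_on with
  | empty => simp
  | insert a s ha ih =>
    rw [Finset.sup_insert, Finset.card_insert_of_notMem ha, add_mul, one_mul, add_comm]
    have : Module.Finite K (s.sup p : Submodule K V) := Submodule.finite_finset_sup s p
    exact (Submodule.finrank_add_le_finrank_add_finrank _ _).trans (Nat.add_le_add
      (h a (Finset.mem_insert_self _ _)) (ih fun i hi => h i (Finset.mem_insert_of_mem hi)))

/-! ### Bounds for the Gelfand–Kirillov dimension -/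

section GKDimension

variable {F : Type u} {R : Type v} {M : Type w} [Field F] [Ring R] [Algebra F R]
  [AddCommGroup M] [Module F M] [Module Rᵐᵒᵖ M]

theorem ENNReal.log_natCast_pow_le {C s k n : ℕ} (hk : 2 ≤ k) (h : n ≤ C * k ^ s) :
    ENNReal.log n / ((Real.log k : ℝ) : EReal)
      ≤ ((Real.log (C + 1) / Real.log k + s : ℝ) : EReal) := by
  have hlog : 0 < Real.log k := Real.log_pos (by exact_mod_cast hk)
  have hk0 : (0 : ℝ) < k := by positivity
  rw [EReal.div_le_iff_le_mul (by exact_mod_cast hlog) (EReal.coe_ne_top _), ← EReal.coe_mul]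
  have h1 : (n : ENNReal) ≤ ENNReal.ofReal ((C + 1) * (k : ℝ) ^ s) := by
    rw [← ENNReal.ofReal_natCast]
    refine ENNReal.ofReal_le_ofReal ?_
    have : (n : ℝ) ≤ C * (k : ℝ) ^ s := by exact_mod_cast h
    have : (0 : ℝ) < (k : ℝ) ^ s := by positivity
    linarith
  refine (ENNReal.log_monotone h1).trans ?_
  rw [ENNReal.log_ofReal_of_pos (by positivity), EReal.coe_le_coe_iff,
    Real.log_mul (by positivity) (by positivity), Real.log_pow]
  rw [mul_add, mul_div_cancel₀ _ hlog.ne']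
  linarith

/-- Polynomial growth of degree `s` bounds the Gelfand–Kirillov dimension by `s`. -/
theorem gkDim_le_of_finrank_le (s : ℕ)
    (h : ∀ (V : Submodule F R) (W : Submodule F M), V.FG → W.FG →
      ∃ C : ℕ, ∀ k : ℕ, 1 ≤ k → Module.finrank F (subspaceMul W (V ^ k)) ≤ C * k ^ s) :
    gkDim F R M ≤ s := by
  refine iSup_le fun V => iSup_le fun W => iSup_le fun hV => iSup_le fun hW => ?_
  obtain ⟨C, hC⟩ := h V W hV hW
  have hlim : Tendsto (fun k : ℕ => ((Real.log (C + 1) / Real.log k + s : ℝ) : EReal)) atTop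
      (nhds ((s : ℝ) : EReal)) := by
    refine (continuous_coe_real_ereal.tendsto _).comp ?_
    have := (tendsto_const_nhds (x := Real.log (C + 1))).div_atTop
      (Real.tendsto_log_atTop.comp tendsto_natCast_atTop_atTop)
    simpa using this.add_const (s : ℝ)
  have := hlim.limsup_eq
  rw [show ((s : ℕ) : EReal) = ((s : ℝ) : EReal) by simp, ← this]
  refine limsup_le_limsup ?_
  filter_upwards [eventually_ge_atTop 2] with k hk
  exact ENNReal.log_natCast_pow_le hk (hC k (by omega))

theorem gkDim_eq_bot_of_finrank_eq_zero
    (h : ∀ (V : Submodule F R) (W : Submodule F M), V.FG → W.FG →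
      ∀ k : ℕ, 1 ≤ k → Module.finrank F (subspaceMul W (V ^ k)) = 0) :
    gkDim F R M = ⊥ := by
  rw [eq_bot_iff]
  refine iSup_le fun V => iSup_le fun W => iSup_le fun hV => iSup_le fun hW => ?_
  refine (limsup_le_of_le (h := ?_))
  filter_upwards [eventually_ge_atTop 2] with k hk
  have hlog : 0 < Real.log k := Real.log_pos (by exact_mod_cast hk)
  rw [h V W hV hW k (by omega), Nat.cast_zero, ENNReal.log_zero,
    EReal.bot_div_of_pos_ne_top (by exact_mod_cast hlog) (EReal.coe_ne_top _)]

theorem le_gkDim_of_pow_le_finrank (s : ℕ) {V : Submodule F R} {W : Submodule F M} (hV : V.FG)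
    (hW : W.FG) (h : ∀ k : ℕ, k ^ s ≤ Module.finrank F (subspaceMul W (V ^ k))) :
    (s : EReal) ≤ gkDim F R M := by
  refine le_iSup_of_le V <| le_iSup_of_le W <| le_iSup_of_le hV <| le_iSup_of_le hW ?_
  refine le_limsup_of_frequently_le (Eventually.frequently ?_)
  filter_upwards [eventually_ge_atTop 2] with k hk
  have hlog : 0 < Real.log k := Real.log_pos (by exact_mod_cast hk)
  have hk0 : (0 : ℝ) < k := by positivity
  rw [EReal.le_div_iff_mul_le (by exact_mod_cast hlog) (EReal.coe_ne_top _)]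
  refine le_trans ?_ (ENNReal.log_monotone (Nat.cast_le.mpr (h k)))
  rw [← ENNReal.ofReal_natCast, ENNReal.log_ofReal_of_pos (by positivity), Nat.cast_pow,
    Real.log_pow, show ((s : ℕ) : EReal) = ((s : ℝ) : EReal) by simp, ← EReal.coe_mul]

theorem subspaceMul_le {W : Submodule F M} {U : Submodule F R} {X : Submodule F M}
    (h : ∀ w ∈ W, ∀ u ∈ U, MulOpposite.op u • w ∈ X) : subspaceMul W U ≤ X := by
  refine Submodule.span_le.mpr ?_
  rintro _ ⟨w, hw, u, hu, rfl⟩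
  exact h w hw u hu

theorem smul_mem_subspaceMul {W : Submodule F M} {U : Submodule F R} {w : M} {u : R}
    (hw : w ∈ W) (hu : u ∈ U) : MulOpposite.op u • w ∈ subspaceMul W U :=
  Submodule.subset_span ⟨w, hw, u, hu, rfl⟩

end GKDimension

namespace TwistedGroupAlgebra

/-! ### Subspaces of elements with given support -/

section Supported

variable {F : Type u} {A : Type v} [Field F] [CommGroup A] {c : TwoCocycle F A}

/-- The subspace of `F * A` of the elements with support in the subset `Z` of `A`. -/
noncomputable def supportedOn (c : TwoCocycle F A) (Z : Set A) :
    Submodule F (TwistedGroupAlgebra c) :=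
  Submodule.span F (basis c '' Z)

theorem mem_supportedOn {Z : Set A} {x : TwistedGroupAlgebra c} :
    x ∈ supportedOn c Z ↔ ∀ a ∈ x.support, a ∈ Z :=
  (basis c).mem_span_image

theorem mem_subgroupAlgebra {B : Subgroup A} {x : TwistedGroupAlgebra c} :
    x ∈ subgroupAlgebra c B ↔ x ∈ supportedOn c (B : Set A) :=
  mem_supportedOn.symm

theorem mem_supportedOn_support (x : TwistedGroupAlgebra c) :
    x ∈ supportedOn c (x.support : Set A) :=
  mem_supportedOn.mpr fun _ h => h

theorem supportedOn_mono {Y Z : Set A} (h : Y ⊆ Z) : supportedOn c Y ≤ supportedOn c Z :=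
  Submodule.span_mono (Set.image_mono h)

theorem basis_mem_supportedOn {Z : Set A} {a : A} (h : a ∈ Z) : basis c a ∈ supportedOn c Z :=
  Submodule.subset_span ⟨a, h, rfl⟩

theorem mul_mem_supportedOn {Y Z : Set A} {x y : TwistedGroupAlgebra c}
    (hx : x ∈ supportedOn c Y) (hy : y ∈ supportedOn c Z) : x * y ∈ supportedOn c (Y * Z) := by
  classical
  rw [mem_supportedOn] at *
  intro d hd
  obtain ⟨a, ha, b, hb, rfl⟩ := Finset.mem_mul.mp (support_mul x y hd)
  exact Set.mul_mem_mul (hx a ha) (hy b hb)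

theorem basis_mul (a b : A) :
    basis c (a * b) = ((c.toFun a b)⁻¹ : Fˣ) • (basis c a * basis c b) := by
  rw [basis_mul_basis, ← Units.smul_def, inv_smul_smul]

theorem supportedOn_mul (Y Z : Set A) :
    supportedOn c (Y * Z) = supportedOn c Y * supportedOn c Z := by
  refine le_antisymm (Submodule.span_le.mpr ?_) (Submodule.mul_le.mpr fun x hx y hy =>
    mul_mem_supportedOn hx hy)
  rintro _ ⟨_, ⟨a, ha, b, hb, rfl⟩, rfl⟩
  rw [basis_mul, Units.smul_def]
  exact Submodule.smul_mem _ _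
    (Submodule.mul_mem_mul (basis_mem_supportedOn ha) (basis_mem_supportedOn hb))

theorem supportedOn_one : supportedOn c (1 : Set A) = 1 := by
  rw [supportedOn, Set.image_one, Submodule.one_eq_span, one_def]
  exact (Submodule.span_singleton_group_smul_eq F _ _).symm

theorem supportedOn_pow (Z : Set A) (k : ℕ) : supportedOn c (Z ^ k) = supportedOn c Z ^ k := by
  induction k with
  | zero => rw [pow_zero, pow_zero, supportedOn_one]
  | succ k ih => rw [pow_succ, pow_succ, supportedOn_mul, ih]

theorem supportedOn_fg {Z : Set A} (h : Z.Finite) : (supportedOn c Z).FG :=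
  Submodule.fg_span (h.image _)

theorem finrank_supportedOn {Z : Set A} (h : Z.Finite) :
    Module.finrank F (supportedOn c Z) = Z.ncard := by
  have : Fintype Z := h.fintype
  have h1 : supportedOn c Z = Submodule.span F (Set.range fun z : Z => basis c z) := by
    rw [supportedOn, Set.image_eq_range]
  have h2 : LinearIndependent F fun z : Z => basis c z :=
    (basis c).linearIndependent.comp _ Subtype.val_injective
  rw [h1, finrank_span_eq_card h2, Set.ncard_eq_toFinset_card', Set.toFinset_card]

/-- A finite-dimensional subspace has its support in a finite set. -/
theorem exists_finite_le_supportedOn {V : Submodule F (TwistedGroupAlgebra c)} (hV : V.FG) :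
    ∃ Z : Set A, Z.Finite ∧ V ≤ supportedOn c Z := by
  classical
  obtain ⟨s, rfl⟩ := hV
  refine ⟨(s.biUnion support : Finset A), Finset.finite_toSet _, Submodule.span_le.mpr ?_⟩
  intro x hx
  refine mem_supportedOn.mpr fun a ha => ?_
  exact Finset.mem_coe.mpr (Finset.mem_biUnion.mpr ⟨x, hx, ha⟩)

theorem support_bar_zpow (a : A) (i : ℤ) :
    (((bar c a) ^ i : (TwistedGroupAlgebra c)ˣ) : TwistedGroupAlgebra c) ∈
      supportedOn c {a ^ i} := by
  have h1 : ((bar c a : (TwistedGroupAlgebra c)ˣ) : TwistedGroupAlgebra c) ∈ supportedOn c {a} :=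
    basis_mem_supportedOn rfl
  have h2 : (((bar c a)⁻¹ : (TwistedGroupAlgebra c)ˣ) : TwistedGroupAlgebra c) ∈
      supportedOn c {a⁻¹} := by
    change ((c.toFun a a⁻¹ * c.toFun 1 1)⁻¹ : Fˣ) • basis c a⁻¹ ∈ _
    rw [Units.smul_def]
    exact Submodule.smul_mem _ _ (basis_mem_supportedOn rfl)
  induction i with
  | zero =>
    rw [zpow_zero, zpow_zero, Units.val_one, Set.singleton_one, supportedOn_one]
    exact Submodule.one_le.mp le_rfl
  | succ i ih =>
    rw [zpow_add_one, zpow_add_one, Units.val_mul, ← Set.singleton_mul_singleton]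
    exact mul_mem_supportedOn ih h1
  | pred i ih =>
    rw [zpow_sub_one, zpow_sub_one, Units.val_mul, ← Set.singleton_mul_singleton]
    exact mul_mem_supportedOn ih h2

theorem exists_smul_bar_zpow (a : A) (i : ℤ) :
    ∃ r : F, basis c (a ^ i) =
      r • (((bar c a) ^ i : (TwistedGroupAlgebra c)ˣ) : TwistedGroupAlgebra c) := by
  have h := support_bar_zpow (c := c) a i
  rw [supportedOn, Set.image_singleton, Submodule.mem_span_singleton] at h
  obtain ⟨r, hr⟩ := h
  have hr0 : r ≠ 0 := by
    rintro rfl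
    rw [zero_smul] at hr
    have h0 : (1 : TwistedGroupAlgebra c) = 0 := by
      rw [← Units.mul_inv (bar c a ^ i), ← hr, zero_mul]
    exact (basis c).ne_zero 1 (by rw [← one_mul (basis c 1), h0, zero_mul])
  exact ⟨r⁻¹, by rw [← hr, inv_smul_smul₀ hr0]⟩

end Supported

/-! ### Cubes in finitely generated torsion-free abelian groups -/

section Box

variable {A : Type v} [CommGroup A] {r : ℕ} (e : Multiplicative (Fin r → ℤ) →* A)

/-- The image in `A` of the cube `[-L, L]^r`, under a parametrization of a subgroup of `A` by
`ℤ^r`. -/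
def box (L : ℕ) : Set A :=
  (fun v : Fin r → ℤ => e (Multiplicative.ofAdd v)) '' {v | ∀ i, |v i| ≤ L}

variable {e}

theorem box_finite (L : ℕ) : (box e L).Finite := by
  refine Set.Finite.image _ ((Set.finite_Icc (fun _ => -(L : ℤ)) fun _ => (L : ℤ)).subset ?_)
  exact fun v hv => ⟨fun i => (abs_le.mp (hv i)).1, fun i => (abs_le.mp (hv i)).2⟩

theorem box_mono {K L : ℕ} (h : K ≤ L) : box e K ⊆ box e L :=
  Set.image_mono fun _ hv i => (hv i).trans (by exact_mod_cast h)

theorem one_mem_box (L : ℕ) : (1 : A) ∈ box e L :=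
  ⟨0, by simp, by simp⟩

theorem box_mul_box (K L : ℕ) : box e K * box e L ⊆ box e (K + L) := by
  rintro _ ⟨_, ⟨v, hv, rfl⟩, _, ⟨w, hw, rfl⟩, rfl⟩
  refine ⟨v + w, fun i => ?_, by simp⟩
  rw [Pi.add_apply, Nat.cast_add]
  exact (abs_add_le _ _).trans (add_le_add (hv i) (hw i))

theorem box_subset_range (L : ℕ) : box e L ⊆ e.range := by
  rintro _ ⟨v, -, rfl⟩
  exact ⟨_, rfl⟩

theorem box_subset_pow (k : ℕ) : box e k ⊆ box e 1 ^ k := by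
  induction k with
  | zero =>
    rintro _ ⟨v, hv, rfl⟩
    obtain rfl : v = 0 := funext fun i => by simpa using hv i
    simp
  | succ k ih =>
    rintro _ ⟨v, hv, rfl⟩
    refine ⟨_, ih ⟨fun i => v i - (v i).sign, fun i => ?_, rfl⟩, _,
      ⟨fun i => (v i).sign, fun i => ?_, rfl⟩, ?_⟩
    · have := abs_le.mp (hv i)
      push_cast at this
      dsimp only
      rw [abs_le]
      rcases lt_trichotomy (v i) 0 with h | h | h
      · rw [Int.sign_eq_neg_one_of_neg h]; omega
      · rw [h]; simp
      · rw [Int.sign_eq_one_of_pos h]; omega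
    · dsimp only
      rw [abs_le]
      rcases lt_trichotomy (v i) 0 with h | h | h
      · rw [Int.sign_eq_neg_one_of_neg h]; simp
      · rw [h]; simp
      · rw [Int.sign_eq_one_of_pos h]; simp
    · dsimp only
      rw [← map_mul, ← ofAdd_add]
      congr 2
      funext i
      simp

theorem ncard_box (he : Function.Injective e) (L : ℕ) : (box e L).ncard = (2 * L + 1) ^ r := by
  have h : {v : Fin r → ℤ | ∀ i, |v i| ≤ L} =
      (Finset.Icc (fun _ => -(L : ℤ)) fun _ => (L : ℤ) : Finset (Fin r → ℤ)) := by
    ext v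
    simp only [Set.mem_ofPred_eq, abs_le, Finset.coe_Icc, Set.mem_Icc, Pi.le_def, forall_and]
  rw [box, Set.ncard_image_of_injective _ (fun v w hvw => by simpa using he hvw), h,
    Set.ncard_coe_finset, Pi.card_Icc]
  simp only [Int.card_Icc, Finset.prod_const, Finset.card_univ, Fintype.card_fin]
  congr 1
  omega

theorem exists_subset_box {Z : Set A} (hZ : Z.Finite) (h : Z ⊆ e.range) :
    ∃ L, Z ⊆ box e L := by
  induction Z, hZ using Set.Finite.induction_on with
  | empty => exact ⟨0, Set.empty_subset _⟩
  | @insert a Z ha hZ ih =>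
    obtain ⟨L, hL⟩ := ih ((Set.subset_insert _ _).trans h)
    obtain ⟨v, rfl⟩ := h (Set.mem_insert _ _)
    refine ⟨L + ∑ i, (v.toAdd i).natAbs, Set.insert_subset ⟨v.toAdd, fun i => ?_, rfl⟩
      (hL.trans (box_mono (by omega)))⟩
    have := Finset.single_le_sum (f := fun i => (v.toAdd i).natAbs) (fun _ _ => Nat.zero_le _)
      (Finset.mem_univ i)
    rw [Int.abs_eq_natAbs]
    omega

/-- A subgroup of a finitely generated torsion-free abelian group is isomorphic to some `ℤ^r`. -/
theorem exists_injective_range_eq [Group.FG A] [IsMulTorsionFree A] (B : Subgroup A) :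
    ∃ (r : ℕ) (e : Multiplicative (Fin r → ℤ) →* A), Function.Injective e ∧ e.range = B := by
  have : Module.Finite ℤ (Additive A) := Module.Finite.iff_addGroup_fg.mpr inferInstance
  let B' : Submodule ℤ (Additive A) := AddSubgroup.toIntSubmodule (Subgroup.toAddSubgroup B)
  have : Module.Free ℤ B' := inferInstance
  let b := Module.finBasis ℤ B'
  let g : (Fin (Module.finrank ℤ B') → ℤ) →+ Additive A :=
    (B'.subtype ∘ₗ b.equivFun.symm.toLinearMap).toAddMonoidHom
  refine ⟨_, AddMonoidHom.toMultiplicativeLeft g, ?_, ?_⟩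
  · intro v w h
    exact b.equivFun.symm.injective (Subtype.val_injective h)
  · ext a
    constructor
    · rintro ⟨v, rfl⟩
      exact (b.equivFun.symm v.toAdd).2
    · intro ha
      refine ⟨Multiplicative.ofAdd (b.equivFun ⟨Additive.ofMul a, ha⟩), ?_⟩
      change Additive.toMul ((b.equivFun.symm (b.equivFun _) : B') : Additive A) = a
      rw [LinearEquiv.symm_apply_apply]
      rfl

theorem box_pow_subset (K k : ℕ) : box e K ^ k ⊆ box e (K * k) := by
  induction k with
  | zero =>
    rw [pow_zero, Set.one_subset]
    exact one_mem_box _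
  | succ k ih =>
    rw [pow_succ, Nat.mul_succ]
    exact (Set.mul_subset_mul_right ih).trans (box_mul_box _ _)

/-- The parametrization of `⟨t⟩ B` by `ℤ^(r + 1)` that extends a parametrization of `B` by `ℤ^r`;
the coordinate `0` is the exponent of `t`. -/
def extendHom (t : A) (e : Multiplicative (Fin r → ℤ) →* A) :
    Multiplicative (Fin (r + 1) → ℤ) →* A where
  toFun v := t ^ v.toAdd 0 * e (Multiplicative.ofAdd (Fin.tail v.toAdd))
  map_one' := by
    have : Fin.tail (0 : Fin (r + 1) → ℤ) = 0 := rfl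
    simp [this]
  map_mul' v w := by
    have : Fin.tail (v.toAdd + w.toAdd) = Fin.tail v.toAdd + Fin.tail w.toAdd := rfl
    rw [toAdd_mul, Pi.add_apply, zpow_add, this, ofAdd_add, map_mul]
    ac_rfl

theorem mem_box_extendHom {t a : A} {K : ℕ} (h : a ∈ box (extendHom t e) K) :
    ∃ i : ℤ, |i| ≤ K ∧ ∃ b ∈ box e K, a = t ^ i * b := by
  obtain ⟨v, hv, rfl⟩ := h
  exact ⟨v 0, hv 0, _, ⟨Fin.tail v, fun i => hv i.succ, rfl⟩, rfl⟩

theorem range_extendHom {t : A}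
    (ht : Subgroup.zpowers (QuotientGroup.mk t : A ⧸ e.range) = ⊤) :
    (extendHom t e).range = ⊤ := by
  rw [eq_top_iff]
  rintro a -
  obtain ⟨i, hi⟩ : (QuotientGroup.mk a : A ⧸ e.range) ∈
      Subgroup.zpowers (QuotientGroup.mk t : A ⧸ e.range) := ht ▸ Subgroup.mem_top _
  have hi' : (QuotientGroup.mk (t ^ i) : A ⧸ e.range) = QuotientGroup.mk a := hi
  obtain ⟨v, hv⟩ := QuotientGroup.eq.mp hi'
  refine ⟨Multiplicative.ofAdd (Fin.cons i v.toAdd), ?_⟩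
  change t ^ i * e v = a
  rw [hv, mul_inv_cancel_left]

end Box

/-! ### Reduction modulo a unitary element -/

section Reduction

variable {F : Type u} {A : Type v} [Field F] [CommGroup A] {c : TwoCocycle F A}
  {I : Submodule (TwistedGroupAlgebra c)ᵐᵒᵖ (TwistedGroupAlgebra c)} {B : Subgroup A} {t : A}
  {r : ℕ} {e : Multiplicative (Fin r → ℤ) →* A}

theorem mul_mem_of_mem_rightIdeal {x : TwistedGroupAlgebra c} (hx : x ∈ I)
    (y : TwistedGroupAlgebra c) : x * y ∈ I :=
  I.smul_mem (MulOpposite.op y) hx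

theorem mem_sup_supportedOn_mono {Y Z : Set A} (h : Y ⊆ Z) {x : TwistedGroupAlgebra c}
    (hx : x ∈ I.restrictScalars F ⊔ supportedOn c Y) :
    x ∈ I.restrictScalars F ⊔ supportedOn c Z :=
  (sup_le_sup (le_refl (I.restrictScalars F)) (supportedOn_mono h)) hx

theorem mul_mem_rightIdeal_sup_supportedOn {Y Z : Set A} {x y : TwistedGroupAlgebra c}
    (hx : x ∈ I.restrictScalars F ⊔ supportedOn c Y) (hy : y ∈ supportedOn c Z) :
    x * y ∈ I.restrictScalars F ⊔ supportedOn c (Y * Z) := by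
  obtain ⟨x₁, h₁, x₂, h₂, rfl⟩ := Submodule.mem_sup.mp hx
  rw [add_mul]
  exact Submodule.add_mem_sup (mul_mem_of_mem_rightIdeal (I := I) h₁ y) (mul_mem_supportedOn h₂ hy)

/-- If the coefficient of `t̄^s` in an element of a right ideal `I` is a unit of `F * B`, then
modulo `I` the element `t̄^s` is a combination of the other powers of `t̄`. -/
theorem basis_zpow_mem_of_isUnit {J : Finset ℤ} {s : ℤ} (hs : s ∈ J)
    (β : ℤ → subgroupAlgebra c B) (hβ : IsUnit (β s))
    (hI : ∑ i ∈ J, (β i : TwistedGroupAlgebra c) *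
      ((bar c t ^ i : (TwistedGroupAlgebra c)ˣ) : TwistedGroupAlgebra c) ∈ I) :
    basis c (t ^ s) ∈ I.restrictScalars F ⊔
      supportedOn c ((fun j : ℤ => t ^ j) '' (J.erase s : Finset ℤ) * (B : Set A)) := by
  obtain ⟨r, hr⟩ := exists_smul_bar_zpow (c := c) t s
  rw [hr]
  apply Submodule.smul_mem
  obtain ⟨γ, hγ⟩ := hβ.exists_right_inv
  have hγ' : (β s : TwistedGroupAlgebra c) * γ = 1 := congrArg Subtype.val hγ
  set T : ℤ → TwistedGroupAlgebra c := fun i =>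
    ((bar c t ^ i : (TwistedGroupAlgebra c)ˣ) : TwistedGroupAlgebra c) with hT
  have hTT : ∀ i j, T i * T j = T (i + j) := fun i j => by
    simp only [hT]
    rw [← Units.val_mul, zpow_add]
  have hT0 : T 0 = 1 := by simp [hT]
  change T s ∈ _
  have hprod := mul_mem_of_mem_rightIdeal hI (T (-s) * γ * T s)
  rw [Finset.sum_mul, ← Finset.add_sum_erase J _ hs] at hprod
  have htop : (β s : TwistedGroupAlgebra c) * T s * (T (-s) * γ * T s) = T s := by
    rw [← mul_assoc, ← mul_assoc, mul_assoc _ (T s), hTT, add_neg_cancel, hT0, mul_one, hγ',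
      one_mul]
  rw [htop] at hprod
  rw [← add_sub_cancel_right (T s) (∑ i ∈ J.erase s,
    (β i : TwistedGroupAlgebra c) * (bar c t ^ i : (TwistedGroupAlgebra c)ˣ) *
      (T (-s) * γ * T s))]
  refine Submodule.sub_mem _ (Submodule.mem_sup_left hprod) (Submodule.mem_sup_right ?_)
  refine Submodule.sum_mem _ fun i hi => ?_
  have hi' : (β i : TwistedGroupAlgebra c) * T i * (T (-s) * γ * T s) ∈
      supportedOn c ((B : Set A) * {t ^ i} * ({t ^ (-s)} * (B : Set A) * {t ^ s})) :=
    mul_mem_supportedOn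
      (mul_mem_supportedOn (mem_subgroupAlgebra.mp (β i).2) (support_bar_zpow t i))
      (mul_mem_supportedOn
        (mul_mem_supportedOn (support_bar_zpow t (-s)) (mem_subgroupAlgebra.mp γ.2))
        (support_bar_zpow t s))
  refine supportedOn_mono ?_ hi'
  rintro _ ⟨_, ⟨b, hb, _, rfl, rfl⟩, _, ⟨_, ⟨_, rfl, b', hb', rfl⟩, _, rfl, rfl⟩, rfl⟩
  refine ⟨_, ⟨i, hi, rfl⟩, _, B.mul_mem hb hb', ?_⟩
  dsimp only
  rw [zpow_neg]
  calc t ^ i * (b * b') = t ^ i * (b * b') * ((t ^ s)⁻¹ * t ^ s) := by simp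
    _ = _ := by ac_rfl

theorem exists_mem_sup_supportedOn_box {P : Set A} {x : TwistedGroupAlgebra c}
    (hx : x ∈ I.restrictScalars F ⊔ supportedOn c (P * (e.range : Set A))) :
    ∃ L, x ∈ I.restrictScalars F ⊔ supportedOn c (P * box e L) := by
  obtain ⟨x₁, h₁, x₂, h₂, rfl⟩ := Submodule.mem_sup.mp hx
  suffices ∃ L, x₂ ∈ supportedOn c (P * box e L) from
    this.imp fun L hL => Submodule.add_mem_sup h₁ hL
  induction h₂ using Submodule.span_induction with
  | mem y hy =>
    obtain ⟨_, ⟨p, hp, b, hb, rfl⟩, rfl⟩ := hy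
    obtain ⟨L, hL⟩ := exists_subset_box (Set.finite_singleton b) (Set.singleton_subset_iff.mpr hb)
    exact ⟨L, basis_mem_supportedOn (Set.mul_mem_mul hp (hL rfl))⟩
  | zero => exact ⟨0, Submodule.zero_mem _⟩
  | add y z hy hz ihy ihz =>
    obtain ⟨K, hK⟩ := ihy (Submodule.add_mem_sup h₁ hy)
    obtain ⟨L, hL⟩ := ihz (Submodule.add_mem_sup h₁ hz)
    exact ⟨K + L, Submodule.add_mem _
      (supportedOn_mono (Set.mul_subset_mul_left (box_mono (by omega))) hK)
      (supportedOn_mono (Set.mul_subset_mul_left (box_mono (by omega))) hL)⟩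
  | smul a y hy ih =>
    obtain ⟨K, hK⟩ := ih (Submodule.add_mem_sup h₁ hy)
    exact ⟨K, Submodule.smul_mem _ _ hK⟩

theorem basis_zpow_add_mem {J J' : Set ℤ} {s k : ℤ} {d : ℕ} (hJ : ∀ j ∈ J, j + k ∈ J')
    (h : basis c (t ^ s) ∈ I.restrictScalars F ⊔
      supportedOn c ((fun j : ℤ => t ^ j) '' J * box e d)) :
    basis c (t ^ (s + k)) ∈ I.restrictScalars F ⊔
      supportedOn c ((fun j : ℤ => t ^ j) '' J' * box e d) := by
  rw [zpow_add, basis_mul, Units.smul_def]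
  refine Submodule.smul_mem _ _ ?_
  have h1 := mul_mem_rightIdeal_sup_supportedOn h
    (basis_mem_supportedOn (c := c) (Set.mem_singleton (t ^ k)))
  refine mem_sup_supportedOn_mono ?_ h1
  rintro _ ⟨_, ⟨_, ⟨j, hj, rfl⟩, b, hb, rfl⟩, _, rfl, rfl⟩
  refine ⟨_, ⟨j + k, hJ j hj, rfl⟩, b, hb, ?_⟩
  dsimp only
  rw [zpow_add]
  ac_rfl

/-- A reduction that rewrites one power of `t̄` at a time: if the elements `t̄^j`, `j ∈ J`, reduce
to `X` modulo `I` with coefficients in the cube of size `L`, then an element reduced to the `t̄^j`,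
`j ∈ J`, with coefficients in the cube of size `d` reduces to `X` with coefficients in the cube of
size `L + d`. -/
theorem mem_sup_supportedOn_trans {J : Set ℤ} {X : Set A} {L d : ℕ} {x : TwistedGroupAlgebra c}
    (hJ : ∀ j ∈ J, basis c (t ^ j) ∈ I.restrictScalars F ⊔ supportedOn c (X * box e L))
    (hx : x ∈ I.restrictScalars F ⊔ supportedOn c ((fun j : ℤ => t ^ j) '' J * box e d)) :
    x ∈ I.restrictScalars F ⊔ supportedOn c (X * box e (L + d)) := by
  refine (sup_le le_sup_left (Submodule.span_le.mpr ?_) :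
    I.restrictScalars F ⊔ supportedOn c ((fun j : ℤ => t ^ j) '' J * box e d) ≤ _) hx
  rintro _ ⟨_, ⟨_, ⟨j, hj, rfl⟩, b, hb, rfl⟩, rfl⟩
  dsimp only
  rw [basis_mul, Units.smul_def]
  refine Submodule.smul_mem _ _ ?_
  have h1 := mul_mem_rightIdeal_sup_supportedOn (hJ j hj) (basis_mem_supportedOn (c := c) hb)
  rw [mul_assoc] at h1
  exact mem_sup_supportedOn_mono (Set.mul_subset_mul_left (box_mul_box L d)) h1

/-- Modulo a right ideal containing a unitary element, `t̄^i b̄` is a combination of finitely many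
fixed powers of `t̄` with coefficients in `F * B` whose support grows linearly. This uses that
conjugation by `t̄` preserves supports. -/
theorem exists_basis_mem_sup_supportedOn_box {α : TwistedGroupAlgebra c} (hα : α ∈ I)
    (hu : IsUnitary c B t α) (he : e.range = B) :
    ∃ (J : Finset ℤ) (D : ℕ), ∀ (K : ℕ) (i : ℤ), |i| ≤ K → ∀ b ∈ box e K,
      basis c (t ^ i * b) ∈ I.restrictScalars F ⊔
        supportedOn c ((fun j : ℤ => t ^ j) '' (J : Set ℤ) * box e (D * (K + 1))) := by
  obtain ⟨p, q, β, hpq, hp, hq, rfl⟩ := hu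
  subst he
  obtain ⟨d₁, h₁⟩ := exists_mem_sup_supportedOn_box
    (basis_zpow_mem_of_isUnit (Finset.left_mem_Icc.mpr hpq) β hp hα)
  obtain ⟨d₂, h₂⟩ := exists_mem_sup_supportedOn_box
    (basis_zpow_mem_of_isUnit (Finset.right_mem_Icc.mpr hpq) β hq hα)
  set d := d₁ + d₂ with hd
  have h₁ := mem_sup_supportedOn_mono (Set.mul_subset_mul_left
    (box_mono (by omega : d₁ ≤ d))) h₁
  have h₂ := mem_sup_supportedOn_mono (Set.mul_subset_mul_left
    (box_mono (by omega : d₂ ≤ d))) h₂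
  set J := Finset.Ico p q with hJ
  -- Each of the `N` steps adds one exponent at both ends of the interval `[p - N, q + N)` and costs
  -- a coefficient supported in the cube of size `d`.
  have key : ∀ (N : ℕ) (i : ℤ), p - N ≤ i → i < q + N → basis c (t ^ i) ∈
      I.restrictScalars F ⊔
        supportedOn c ((fun j : ℤ => t ^ j) '' (J : Set ℤ) * box e (d * N)) := by
    intro N
    induction N with
    | zero =>
      intro i hi hi'
      refine Submodule.mem_sup_right (basis_mem_supportedOn ?_)
      refine ⟨t ^ i, ⟨i, ?_, rfl⟩, 1, one_mem_box _, mul_one _⟩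
      simp only [hJ, Finset.coe_Ico, Set.mem_Ico]
      push_cast at hi hi'
      omega
    | succ N ih =>
      intro i hi hi'
      push_cast at hi hi'
      have ih' : ∀ j ∈ Set.Ico (p - N) (q + N), basis c (t ^ j) ∈ I.restrictScalars F ⊔
          supportedOn c ((fun j : ℤ => t ^ j) '' (J : Set ℤ) * box e (d * N)) :=
        fun j hj => ih j hj.1 hj.2
      by_cases hlo : i < p - N
      · obtain rfl : i = p + (-N - 1) := by omega
        refine mem_sup_supportedOn_trans ih' (basis_zpow_add_mem ?_ h₁)
        intro j hj
        simp only [Finset.coe_erase, Finset.coe_Icc, Set.mem_sdiff, Set.mem_Icc,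
          Set.mem_singleton_iff] at hj
        simp only [Set.mem_Ico]
        omega
      by_cases hhi : q + N ≤ i
      · obtain rfl : i = q + N := by omega
        refine mem_sup_supportedOn_trans ih' (basis_zpow_add_mem ?_ h₂)
        intro j hj
        simp only [Finset.coe_erase, Finset.coe_Icc, Set.mem_sdiff, Set.mem_Icc,
          Set.mem_singleton_iff] at hj
        simp only [Set.mem_Ico]
        omega
      · exact mem_sup_supportedOn_mono (Set.mul_subset_mul_left
          (box_mono (Nat.mul_le_mul_left _ (Nat.le_succ N)))) (ih i (by omega) (by omega))
  obtain ⟨s, hs₁, hs₂⟩ : ∃ s : ℕ, p ≤ s ∧ -q ≤ s := ⟨p.natAbs + q.natAbs, by omega, by omega⟩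
  refine ⟨J, d * (s + 1) + 1, fun K i hi b hb => ?_⟩
  have hi := abs_le.mp hi
  have h := mul_mem_rightIdeal_sup_supportedOn
    (key (K + (s + 1)) i (by push_cast; omega) (by push_cast; omega))
    (basis_mem_supportedOn (c := c) hb)
  rw [basis_mul, Units.smul_def]
  refine Submodule.smul_mem _ _ (mem_sup_supportedOn_mono ?_ h)
  rw [mul_assoc]
  refine Set.mul_subset_mul_left ((box_mul_box _ _).trans (box_mono ?_))
  calc d * (K + (s + 1)) + K
      ≤ d * ((s + 1) * (K + 1)) + (K + 1) := by
        refine Nat.add_le_add (Nat.mul_le_mul_left _ ?_) (Nat.le_succ K)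
        nlinarith [Nat.zero_le (s * K)]
    _ = _ := by ring

end Reduction

/-! ### Growth of torsion modules and of modules with a free vector -/

section Growth

variable {F : Type u} {A : Type v} [Field F] [CommGroup A] {c : TwoCocycle F A}
  {I : Submodule (TwistedGroupAlgebra c)ᵐᵒᵖ (TwistedGroupAlgebra c)} {B : Subgroup A} {t : A}
  {r : ℕ} {e : Multiplicative (Fin r → ℤ) →* A}
  {N : Type w} [AddCommGroup N] [Module F N]

/-- A cyclic `F * B`-module with a nonzero annihilator grows more slowly than `F * B`: the kernel
of `φ` on the elements supported in the cube of size `L` contains `b x` for every `x` supported in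
the cube of size `L - d`, and the two cubes differ by `O(L ^ (r - 1))` points. -/
theorem finrank_map_supportedOn_box_le [NoZeroDivisors (TwistedGroupAlgebra c)]
    (he : Function.Injective e) (φ : TwistedGroupAlgebra c →ₗ[F] N) {b : TwistedGroupAlgebra c}
    (hb0 : b ≠ 0) {d : ℕ} (hb : b ∈ supportedOn c (box e d)) (hφ : ∀ x, φ (b * x) = 0) {L : ℕ}
    (hL : d ≤ L) :
    Module.finrank F ((supportedOn c (box e L)).map φ)
      ≤ r * (2 * d) * (2 * L + 1) ^ (r - 1) := by
  obtain ⟨K, rfl⟩ := Nat.exists_eq_add_of_le hL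
  set U := supportedOn c (box e (d + K))
  have hfin : ∀ L, Module.Finite F (supportedOn c (box e L)) := fun L =>
    Module.Finite.iff_fg.mpr (supportedOn_fg (box_finite L))
  have := hfin (d + K)
  have := hfin K
  let ψ := φ ∘ₗ U.subtype
  have h1 := ψ.finrank_range_add_finrank_ker
  have h2 : LinearMap.range ψ = U.map φ := by
    rw [LinearMap.range_comp, Submodule.range_subtype]
  let μ : supportedOn c (box e K) →ₗ[F] LinearMap.ker ψ :=
    ((LinearMap.mulLeft F b ∘ₗ (supportedOn c (box e K)).subtype).codRestrict U fun x =>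
      supportedOn_mono (box_mul_box d K) (mul_mem_supportedOn hb x.2)).codRestrict _ fun x =>
        hφ x
  have hμ : Function.Injective μ := fun x y hxy => by
    have h : b * (x : TwistedGroupAlgebra c) = b * y :=
      congrArg Subtype.val (congrArg Subtype.val hxy)
    exact Subtype.ext (mul_left_cancel₀ hb0 h)
  have h3 := LinearMap.finrank_le_finrank_of_injective hμ
  rw [finrank_supportedOn (box_finite K), ncard_box he] at h3
  rw [h2, finrank_supportedOn (box_finite _), ncard_box he] at h1
  have h4 := Nat.add_pow_le_pow_add_mul (2 * K + 1) (2 * d) r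
  rw [show 2 * K + 1 + 2 * d = 2 * (d + K) + 1 by ring] at h4
  omega

variable [Module (TwistedGroupAlgebra c)ᵐᵒᵖ N]

/-- A quotient of `F * A` by a right ideal that contains a unitary element, in which every element
is `F * B`-torsion, has growth of degree at most `r - 1`, where `B ≅ ℤ^r`; it vanishes if
`r = 0`. -/
theorem exists_finrank_subspaceMul_le [NoZeroDivisors (TwistedGroupAlgebra c)]
    (he : Function.Injective e) (heB : e.range = B)
    (ht : Subgroup.zpowers (QuotientGroup.mk t : A ⧸ B) = ⊤)
    {α : TwistedGroupAlgebra c} (hα : α ∈ I) (hu : IsUnitary c B t α)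
    (π : TwistedGroupAlgebra c →ₗ[F] N) (hπ : Function.Surjective π)
    (hmul : ∀ x y, π (x * y) = MulOpposite.op y • π x) (hI : ∀ x ∈ I, π x = 0)
    (htors : ∀ x, ∃ b ∈ subgroupAlgebra c B, b ≠ 0 ∧ π (x * b) = 0)
    {V : Submodule F (TwistedGroupAlgebra c)} {W : Submodule F N} (hV : V.FG) (hW : W.FG) :
    ∃ C : ℕ, ∀ k : ℕ, 1 ≤ k →
      Module.finrank F (subspaceMul W (V ^ k)) ≤ r * C * k ^ (r - 1) := by
  classical
  obtain ⟨J, D, hD⟩ := exists_basis_mem_sup_supportedOn_box hα hu heB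
  subst heB
  -- A common bound `d` for the supports of annihilators of the images of the `t̄^j`, `j ∈ J`.
  choose b hbB hb0 hb using fun j : ℤ => htors (basis c (t ^ j))
  choose d hd using fun j => exists_subset_box (e := e) (b j).support.finite_toSet (hbB j)
  have hbd : ∀ j ∈ J, b j ∈ supportedOn c (box e (J.sup d)) := fun j hj =>
    supportedOn_mono ((hd j).trans (box_mono (Finset.le_sup hj))) (mem_supportedOn_support _)
  -- Cubes of size `K₀`, `K₁` that support lifts of `W` and the space `V`.
  have hfull : ∀ Z : Set A, Z ⊆ (extendHom t e).range := by
    rw [range_extendHom ht]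
    exact fun Z => Set.subset_univ Z
  obtain ⟨Z₁, hZ₁, hV₁⟩ := exists_finite_le_supportedOn hV
  obtain ⟨K₁, hK₁⟩ := exists_subset_box hZ₁ (hfull Z₁)
  obtain ⟨s, rfl⟩ := hW
  obtain ⟨Z₀, hZ₀, hV₀⟩ := exists_finite_le_supportedOn
    (Submodule.fg_span (R := F) (s.finite_toSet.image (Function.surjInv hπ)))
  obtain ⟨K₀, hK₀⟩ := exists_subset_box hZ₀ (hfull Z₀)
  have hlift : Submodule.span F (s : Set N) ≤
      (supportedOn c (box (extendHom t e) K₀)).map π := by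
    refine Submodule.span_le.mpr fun x hx => ⟨Function.surjInv hπ x, ?_,
      Function.surjInv_eq hπ x⟩
    exact supportedOn_mono hK₀ (hV₀ (Submodule.subset_span ⟨x, hx, rfl⟩))
  -- The image of a cube of `A` lies in finitely many translates of a cube of `B`.
  let φ : ℤ → TwistedGroupAlgebra c →ₗ[F] N := fun j => π ∘ₗ LinearMap.mulLeft F (basis c (t ^ j))
  have hred : ∀ K L, D * (K + 1) ≤ L → (supportedOn c (box (extendHom t e) K)).map π ≤
      J.sup fun j => (supportedOn c (box e L)).map (φ j) := by
    intro K L hKL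
    rw [Submodule.map_le_iff_le_comap]
    refine Submodule.span_le.mpr ?_
    rintro _ ⟨a, ha, rfl⟩
    obtain ⟨i, hi, b', hb', rfl⟩ := mem_box_extendHom ha
    obtain ⟨x₁, h₁, x₂, h₂, h₁₂⟩ := Submodule.mem_sup.mp (hD K i hi b' hb')
    rw [SetLike.mem_coe, Submodule.mem_comap, ← h₁₂, map_add, hI x₁ h₁, zero_add,
      ← Submodule.mem_comap]
    refine (Submodule.span_le.mpr ?_ : supportedOn c _ ≤ _) h₂
    rintro _ ⟨_, ⟨_, ⟨j, hj, rfl⟩, b'', hb'', rfl⟩, rfl⟩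
    dsimp only
    rw [SetLike.mem_coe, Submodule.mem_comap, basis_mul, Units.smul_def, map_smul]
    refine Submodule.smul_mem _ _ ?_
    exact (Finset.le_sup (f := fun j => (supportedOn c (box e L)).map (φ j)) hj)
      ⟨_, basis_mem_supportedOn (box_mono hKL hb''), rfl⟩
  have hfin : ∀ L, Module.Finite F (supportedOn c (box e L)) := fun L =>
    Module.Finite.iff_fg.mpr (supportedOn_fg (box_finite L))
  set E := 2 * (D * (K₀ + K₁ + 1) + J.sup d) + 1 with hE
  refine ⟨J.card * (2 * J.sup d * E ^ (r - 1)), fun k hk => ?_⟩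
  set L := D * (K₀ + K₁ * k + 1) + J.sup d with hL
  have hle : subspaceMul (Submodule.span F (s : Set N)) (V ^ k) ≤
      J.sup fun j => (supportedOn c (box e L)).map (φ j) := by
    refine subspaceMul_le fun w hw u hu => ?_
    obtain ⟨x, hx, rfl⟩ := hlift hw
    rw [← hmul]
    refine hred (K₀ + K₁ * k) L (by omega) ⟨_, ?_, rfl⟩
    have hu' : u ∈ supportedOn c (Z₁ ^ k) := by
      rw [supportedOn_pow]
      exact pow_le_pow_left' hV₁ k hu
    refine supportedOn_mono ?_ (mul_mem_supportedOn hx hu')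
    exact (Set.mul_subset_mul_left ((Set.pow_subset_pow_left hK₁).trans (box_pow_subset _ _))).trans
      (box_mul_box _ _)
  have hfin' : Module.Finite F
      (J.sup fun j => (supportedOn c (box e L)).map (φ j) : Submodule F N) :=
    Submodule.finite_finset_sup _ _
  have hLE : 2 * L + 1 ≤ E * k := by
    have : K₀ + K₁ * k + 1 ≤ (K₀ + K₁ + 1) * k := by nlinarith [Nat.zero_le K₀]
    calc 2 * L + 1 ≤ 2 * (D * ((K₀ + K₁ + 1) * k) + J.sup d * k) + k := by
          rw [hL]
          have := Nat.mul_le_mul_left D this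
          have := Nat.le_mul_of_pos_right (J.sup d) hk
          omega
      _ = E * k := by rw [hE]; ring
  calc Module.finrank F (subspaceMul (Submodule.span F (s : Set N)) (V ^ k))
      ≤ _ := Submodule.finrank_mono hle
    _ ≤ J.card * (r * (2 * J.sup d) * (2 * L + 1) ^ (r - 1)) := by
        refine Submodule.finrank_finset_sup_le _ _ fun j hj => ?_
        refine finrank_map_supportedOn_box_le he (φ j) (hb0 j) (hbd j hj) (fun x => ?_)
          (Nat.le_add_left _ _)
        change π (basis c (t ^ j) * (b j * x)) = 0
        rw [← mul_assoc, hmul, hb, smul_zero]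
    _ ≤ J.card * (r * (2 * J.sup d) * (E * k) ^ (r - 1)) := by gcongr
    _ = _ := by rw [mul_pow]; ring

/-- A module with a vector on which `F * B` acts freely has growth of degree at least `r`, where
`B ≅ ℤ^r`. -/
theorem le_gkDim_of_free (he : Function.Injective e)
    (π : TwistedGroupAlgebra c →ₗ[F] N) (hmul : ∀ x y, π (x * y) = MulOpposite.op y • π x)
    (hfree : ∀ b ∈ supportedOn c (e.range : Set A), π b = 0 → b = 0) :
    (r : EReal) ≤ gkDim F (TwistedGroupAlgebra c) N := by
  have hVk : ∀ k, (supportedOn c (box e 1 ^ k)).FG := fun k =>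
    supportedOn_fg ((box_finite _).subset (box_pow_subset 1 k))
  refine le_gkDim_of_pow_le_finrank r (V := supportedOn c (box e 1)) (W := F ∙ π 1)
    (supportedOn_fg (box_finite 1)) (Submodule.fg_span_singleton _) fun k => ?_
  rw [← supportedOn_pow]
  have hle : subspaceMul (F ∙ π 1) (supportedOn c (box e 1 ^ k)) ≤
      (supportedOn c (box e 1 ^ k)).map π := by
    refine subspaceMul_le fun w hw u hu => ?_
    obtain ⟨a, rfl⟩ := Submodule.mem_span_singleton.mp hw
    rw [← map_smul, ← hmul, smul_mul_assoc, one_mul]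
    exact ⟨_, Submodule.smul_mem _ _ hu, rfl⟩
  have hfin : Module.Finite F (subspaceMul (F ∙ π 1) (supportedOn c (box e 1 ^ k))) := by
    have : Module.Finite F ((supportedOn c (box e 1 ^ k)).map π) :=
      Module.Finite.iff_fg.mpr ((hVk k).map π)
    exact Submodule.finiteDimensional_of_le hle
  let ψ : supportedOn c (box e k) →ₗ[F]
      subspaceMul (F ∙ π 1) (supportedOn c (box e 1 ^ k)) :=
    (π ∘ₗ (supportedOn c (box e k)).subtype).codRestrict _ fun x => by
      have := smul_mem_subspaceMul (Submodule.mem_span_singleton_self (R := F) (π 1))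
        (supportedOn_mono (box_subset_pow k) x.2)
      rwa [← hmul, one_mul] at this
  have hψ : Function.Injective ψ := by
    rw [← LinearMap.ker_eq_bot, Submodule.eq_bot_iff]
    intro x hx
    exact Subtype.ext (hfree x (supportedOn_mono (box_subset_range k) x.2)
      (congrArg Subtype.val (LinearMap.mem_ker.mp hx)))
  refine le_trans ?_ (LinearMap.finrank_le_finrank_of_injective hψ)
  rw [finrank_supportedOn (box_finite k), ncard_box he]
  exact Nat.pow_le_pow_left (by omega) r

end Growth

/-! ### Contraction of maximal right ideals of the ring of fractions -/

section Contraction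

variable {F : Type u} {A : Type v} [Field F] [CommGroup A] [Group.FG A] [IsMulTorsionFree A]
  {c : TwoCocycle F A} {B : Subgroup A}
  {m : Submodule (FractionRing c B)ᵐᵒᵖ (FractionRing c B)}

theorem mem_contraction {x : TwistedGroupAlgebra c} :
    x ∈ contraction m ↔ toFractionRing c B x ∈ m := Iff.rfl

/-- A proper right ideal of `Σ` meets `F * B` trivially. -/
theorem eq_zero_of_mem_contraction (hm : m ≠ ⊤) {b : TwistedGroupAlgebra c}
    (hb : b ∈ subgroupAlgebra c B) (h : b ∈ contraction m) : b = 0 := by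
  by_contra hb0
  refine hm (Submodule.eq_top_iff'.mpr fun z => ?_)
  obtain ⟨y, hy⟩ := (isUnit_toFractionRing (⟨b, hb, hb0⟩ : nonzeroSubmonoid c B)).exists_right_inv
  have := m.smul_mem (MulOpposite.op (y * z)) (mem_contraction.mp h)
  rwa [MulOpposite.smul_eq_mul_unop, MulOpposite.unop_op, ← mul_assoc, hy, one_mul] at this

/-- The contraction of a maximal right ideal `m` of `Σ` has torsion proper quotients: a larger right
ideal `J` generates with `m` the right ideal `Σ`, and clearing denominators turns `Σ = m + yΣ`,
`y ∈ J`, into `x b ∈ J`. -/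
theorem exists_mul_mem_of_contraction_lt (hm : IsCoatom m)
    {J : Submodule (TwistedGroupAlgebra c)ᵐᵒᵖ (TwistedGroupAlgebra c)} (hJ : contraction m < J)
    (x : TwistedGroupAlgebra c) : ∃ b ∈ subgroupAlgebra c B, b ≠ 0 ∧ x * b ∈ J := by
  obtain ⟨hle, y, hyJ, hy⟩ := SetLike.lt_iff_le_and_exists.mp hJ
  have htop : m ⊔ Submodule.span _ {toFractionRing c B y} = ⊤ :=
    hm.2 _ (lt_of_le_of_ne le_sup_left fun h => hy (mem_contraction.mpr
      (h ▸ Submodule.mem_sup_right (Submodule.mem_span_singleton_self _))))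
  obtain ⟨μ, hμ, z', hz', hx⟩ := Submodule.mem_sup.mp
    (htop ▸ Submodule.mem_top : toFractionRing c B x ∈ _)
  obtain ⟨z, rfl⟩ := Submodule.mem_span_singleton.mp hz'
  obtain ⟨a, s, hs⟩ := exists_mul_eq z.unop
  refine ⟨s, s.2.1, s.2.2, ?_⟩
  have h1 : x * s - y * a ∈ contraction m := by
    rw [mem_contraction, map_sub, map_mul, map_mul, ← hx, ← hs, MulOpposite.smul_eq_mul_unop,
      add_mul, mul_assoc _ z.unop, add_sub_cancel_right]
    exact m.smul_mem (MulOpposite.op _) hμ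
  have h2 := J.add_mem (hle h1) (mul_mem_of_mem_rightIdeal hyJ a)
  rwa [sub_add_cancel] at h2

/-- If `𝔪` contains a unitary element, then `𝒜 / (𝒜 ∩ 𝔪)` is GK-critical: its dimension is at least
the rank of `B`, and that of a proper quotient is smaller. -/
theorem isGKCritical_contractionModule (t : A)
    (ht : Subgroup.zpowers (QuotientGroup.mk t : A ⧸ B) = ⊤) (hm : IsCoatom m)
    (hunitary : ∃ α ∈ contraction m, IsUnitary c B t α) :
    IsGKCritical F (TwistedGroupAlgebra c) (ContractionModule m) := by
  intro W₁ hW₁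
  obtain ⟨r, e, he, heB⟩ := exists_injective_range_eq B
  obtain ⟨α, hα, hu⟩ := hunitary
  let π₀ := (contraction m).mkQ
  let π₁ := W₁.mkQ ∘ₗ π₀
  have hlow : (r : EReal) ≤ gkDim F (TwistedGroupAlgebra c) (ContractionModule m) := by
    refine le_gkDim_of_free he (π₀.restrictScalars F) (fun x y => π₀.map_smul (.op y) x) ?_
    intro b hb h
    rw [heB] at hb
    exact eq_zero_of_mem_contraction hm.1 (mem_subgroupAlgebra.mpr hb)
      ((Submodule.Quotient.mk_eq_zero _).mp h)
  have hker : contraction m < LinearMap.ker π₁ := by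
    rw [LinearMap.ker_comp, Submodule.ker_mkQ]
    refine lt_of_le_of_ne (Submodule.le_comap_mkQ _ _) fun h => hW₁ ?_
    rw [← Submodule.map_comap_eq_of_surjective (contraction m).mkQ_surjective W₁]
    refine (congrArg _ h.symm).trans ?_
    exact Submodule.mkQ_map_self _
  have hup : ∀ (V : Submodule F (TwistedGroupAlgebra c))
      (W : Submodule F (ContractionModule m ⧸ W₁)), V.FG → W.FG → ∃ C : ℕ, ∀ k : ℕ, 1 ≤ k →
        Module.finrank F (subspaceMul W (V ^ k)) ≤ r * C * k ^ (r - 1) := fun V W hV hW =>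
    exists_finrank_subspaceMul_le he heB ht hα hu (π₁.restrictScalars F)
      (W₁.mkQ_surjective.comp (contraction m).mkQ_surjective) (fun x y => π₁.map_smul (.op y) x)
      (fun x hx => hker.le hx)
      (fun x => exists_mul_mem_of_contraction_lt hm hker x) hV hW
  refine lt_of_lt_of_le ?_ hlow
  rcases r with _ | r
  -- For `r = 0` the factor `r` of the growth bound makes the quotient zero, of dimension `-∞`.
  · rw [gkDim_eq_bot_of_finrank_eq_zero fun V W hV hW k hk => ?_]
    · exact EReal.bot_lt_coe _
    · obtain ⟨C, hC⟩ := hup V W hV hW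
      simpa using hC k hk
  · refine lt_of_le_of_lt (gkDim_le_of_finrank_le r fun V W hV hW => ?_)
      (by exact_mod_cast Nat.lt_succ_self r)
    obtain ⟨C, hC⟩ := hup V W hV hW
    exact ⟨_, hC⟩

end Contraction

end TwistedGroupAlgebra

/-- `A` is a finitely generated torsion-free abelian group, `A / B` is infinite cyclic and generated
by `tB`, and `m` is a maximal right ideal of the ring of fractions of `F * A` at `F * B \ {0}`. -/
theorem mainTheorem6 {F : Type u} {A : Type v} [Field F] [CommGroup A] [Group.FG A]
    [IsMulTorsionFree A] (c : TwoCocycle F A) (B : Subgroup A) (t : A)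
    (hinf : Infinite (A ⧸ B)) (ht : Subgroup.zpowers (QuotientGroup.mk t : A ⧸ B) = ⊤)
    (m : Submodule (TwistedGroupAlgebra.FractionRing c B)ᵐᵒᵖ
      (TwistedGroupAlgebra.FractionRing c B)) (hm : IsCoatom m)
    (hunitary : ∃ α ∈ TwistedGroupAlgebra.contraction m, TwistedGroupAlgebra.IsUnitary c B t α) :
    IsGKCritical F (TwistedGroupAlgebra c) (TwistedGroupAlgebra.ContractionModule m) := by
  exact TwistedGroupAlgebra.isGKCritical_contractionModule t ht hm hunitary
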